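/- A \emph{polygon} with vertices $v_1,\dots,v_n\in\mathbb{R}^2$ ($n\ge 3$) is a compact set $V\subset\mathbb{R}^2$ that is the closure of its interior $\mathring V$, with $\mathring V$ connected, and whose boundary $\partial V$ is the closed polygonal curve with consecutive edges $[v_1,v_2],\dots,[v_{n-1},v_n],[v_n,v_1]$, this curve being simple (consecutive collinear vertices are allowed). Let $V$ and $W$ be polygons in $\mathbb{R}^2$ with vertices $v_1,\dots,v_n$ and $w_1,\dots,w_n$ respectively, both listed in counterclockwise order. Let $\phi_1,\dots,\phi_n$ be harmonic generalized barycentric coordinate functions over $V$, i.e. continuous functions $\phi_i:V\to\mathbb{R}$, harmonic in $\mathring V$ and linear on each edge of $V$, such that for all $x\in V$ $$\sum_{i=1}^n\phi_i(x)=1,\qquad \sum_{i=1}^n\phi_i(x)\,v_i=x,\qquad \phi_i(x)\ge 0\quad(i=1,\dots,n),$$ and $\phi_i(v_j)=1$ if $i=j$ and $\phi_i(v_j)=0$ if $i\ne j$. Put $$F(x)=\sum_{i=1}^n\phi_i(x)\,w_i,\qquad x\in V.$$ If $W$ is convex, then $F$ is a bijection from $V$ onto $W$. Moreover, $F$ restricts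 to a $C^\infty$ diffeomorphism from $\mathring V$ onto $\mathring W$. -/

import Mathlib

open Set InnerProductSpace
open scoped ContDiff

namespace HarmonicGBC

/-- The Euclidean plane `ℝ²`. -/
abbrev Plane : Type := EuclideanSpace ℝ (Fin 2)

/-- The closed polygonal curve through the cyclically ordered vertices of `P` is simple: the
edges, each parametrized over the half-open interval `[0, 1)` from its initial vertex towards its
final one, run through every point of the curve exactly once. Three consecutive vertices may be
collinear (inactive vertices are allowed), but the curve may not turn back on itself. -/
def IsSimple {n : ℕ} (P : Polygon Plane n) : Prop :=
  ∀ i j : Fin n, ∀ s ∈ Ico (0 : ℝ) 1, ∀ t ∈ Ico (0 : ℝ) 1,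
    P.edgePath ℝ i s = P.edgePath ℝ j t → i = j ∧ s = t

/-- Twice the signed area enclosed by the closed polygonal curve `P` (shoelace formula). -/
noncomputable def twiceSignedArea {n : ℕ} (P : Polygon Plane n) : ℝ :=
  ∑ i : Fin n, (P i 0 * P (finRotate n i) 1 - P (finRotate n i) 0 * P i 1)

/-- The vertices of a simple polygon are listed in the counterclockwise direction. -/
def IsCounterclockwise {n : ℕ} (P : Polygon Plane n) : Prop :=
  0 < twiceSignedArea P

/-- `V` is the (closed, solid) polygon whose vertices are those of `P`, in their cyclic order:
it is the closure of a bounded domain, and its boundary is the simple closed polygonal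
curve through the vertices of `P`. -/
structure IsPolygonalRegion {n : ℕ} (P : Polygon Plane n) (V : Set Plane) : Prop where
  three_le : 3 ≤ n
  isSimple : IsSimple P
  isCompact : IsCompact V
  isConnected_interior : IsConnected (interior V)
  closure_interior : closure (interior V) = V
  frontier_eq : frontier V = P.boundary ℝ

/-- `φ 0, …, φ (n - 1)` are generalized barycentric coordinate functions over the polygon `V`
with vertices `P`. Values outside `V` play no role. -/
structure IsGBC {n : ℕ} (P : Polygon Plane n) (V : Set Plane) (φ : Fin n → Plane → ℝ) :
    Prop where
  sum_eq_one : ∀ x ∈ V, ∑ i, φ i x = 1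
  sum_smul_eq : ∀ x ∈ V, ∑ i, φ i x • P i = x
  nonneg : ∀ x ∈ V, ∀ i, 0 ≤ φ i x
  apply_vertex : ∀ i j, φ i (P j) = if i = j then 1 else 0
  linear_on_edge : ∀ i j, ∀ t ∈ Icc (0 : ℝ) 1,
    φ i (P.edgePath ℝ j t) = (1 - t) * φ i (P j) + t * φ i (P (finRotate n j))

/-- Harmonic GBC functions over `V`: GBC functions that are continuous on `V` and harmonic in the
interior of `V`. -/
structure IsHarmonicGBC {n : ℕ} (P : Polygon Plane n) (V : Set Plane)
    (φ : Fin n → Plane → ℝ) : Prop extends IsGBC P V φ where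
  continuousOn : ∀ i, ContinuousOn (φ i) V
  harmonic : ∀ i, HarmonicOnNhd (φ i) (interior V)

/-- The map `F = ∑ i, φ i • w i` built from the functions `φ i` and the vertices `w i` of `Q`. -/
noncomputable def gbcMap {n : ℕ} (φ : Fin n → Plane → ℝ) (Q : Polygon Plane n) (x : Plane) :
    Plane :=
  ∑ i, φ i x • Q i

/-- `F` restricts to a `C^∞` diffeomorphism from the open set `A` onto the open set `B`. -/
def IsDiffeoOn (F : Plane → Plane) (A B : Set Plane) : Prop :=
  IsOpen A ∧ IsOpen B ∧ BijOn F A B ∧ ContDiffOn ℝ ∞ F A ∧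
    ∃ G : Plane → Plane, InvOn G F A B ∧ ContDiffOn ℝ ∞ G B

end HarmonicGBC

/-! ### Plane topology: continuous logarithms and non-alternation of connected sets. -/

section

open Complex Filter Topology

/-! This is the Radó–Kneser–Choquet theorem for piecewise linear boundary values. `F` maps each edge
of `V` affinely to the matching edge of `W`, so simplicity of the target curve makes `F` a bijection
of boundaries (`IsGBC.bijOn_boundary`). The maximum principle for `l ∘ F`, with `l` a supporting
functional, keeps interior points inside (`mapsTo_interior`).

The heart is invertibility of `dF` at each interior point `x` (`surjective_fderiv`). Otherwise some
nonzero `l` annihilates the range of `dF`, and the harmonic function `h = l ∘ F` has a critical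
point at `x`. The line through `F x` on which `l` is constant cuts the convex curve `∂W` into two
arcs, so `h > h x` and `h < h x` each have connected trace on `∂V`; by the maximum principle both
sets are then connected in `V`. Near a critical point, however, `h - h x` behaves like the real part
of a power with exponent at least 2 and changes sign along four successive rays. Two such connected
sets cannot interlace in the plane (`not_alternating_rays`); this is proved by comparing two
logarithms of one function instead of invoking the Jordan curve theorem.

Thus `F` is a local diffeomorphism of the interiors. It is proper because boundary goes to boundary,
hence a covering of a convex open set, hence bijective. -/

theorem Complex.arg_neg_exp_mul_I {β : ℝ} (h0 : 0 < β) (h1 : β < 2 * Real.pi) :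
    (-Complex.exp (β * I)).arg = β - Real.pi := by
  have : -Complex.exp (β * I) = Complex.exp ((β - Real.pi : ℝ) * I) := by
    push_cast
    rw [sub_mul, Complex.exp_sub, Complex.exp_pi_mul_I, div_neg, div_one]
  rw [this, Complex.arg_exp_mul_I, toIocMod_eq_self]
  constructor <;> linarith

theorem Complex.neg_exp_mul_I_mem_slitPlane {β : ℝ} (h0 : 0 < β) (h1 : β < 2 * Real.pi) :
    -Complex.exp (β * I) ∈ slitPlane := by
  rw [mem_slitPlane_iff_arg, Complex.arg_neg_exp_mul_I h0 h1]
  exact ⟨by linarith, by simp⟩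

theorem Complex.tendsto_arg_one_sub_div {β r : ℝ} (h0 : 0 < β) (h1 : β < 2 * Real.pi)
    (hr : 0 < r) :
    Tendsto (fun t : ℝ ↦ (1 - (r / t : ℝ) * Complex.exp (β * I)).arg) (𝓝[>] 0)
      (𝓝 (β - Real.pi)) := by
  have h : Tendsto (fun t : ℝ ↦ (((t / r : ℝ) : ℂ) - Complex.exp (β * I)).arg) (𝓝[>] 0)
      (𝓝 (β - Real.pi)) := by
    rw [← Complex.arg_neg_exp_mul_I h0 h1]
    refine (continuousAt_arg (Complex.neg_exp_mul_I_mem_slitPlane h0 h1)).tendsto.comp ?_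
    have : Continuous fun t : ℝ ↦ ((t / r : ℝ) : ℂ) - Complex.exp (β * I) := by fun_prop
    simpa using (this.tendsto 0).mono_left nhdsWithin_le_nhds
  refine h.congr' ?_
  filter_upwards [self_mem_nhdsWithin] with t ht
  have ht : 0 < t := ht
  rw [← Complex.arg_real_mul _ (div_pos hr ht)]
  congr 1
  have : (r : ℂ) ≠ 0 := by exact_mod_cast hr.ne'
  have : (t : ℂ) ≠ 0 := by exact_mod_cast ht.ne'
  push_cast
  field_simp

/-- A ratio `(z - q) / (z - q')` with both points in a connected set `B` that stays away from `S`
has a continuous logarithm on `S`. -/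
theorem exists_continuousOn_log_div {S B : Set ℂ} (hB : IsPreconnected B)
    (hSB : Disjoint (closure S) B) {q q' : ℂ} (hq : q ∈ B) (hq' : q' ∈ B) :
    ∃ l : ℂ → ℂ, ContinuousOn l S ∧ ∀ z ∈ S, Complex.exp (l z) = (z - q) / (z - q') := by
  have hne : ∀ z ∈ S, ∀ p ∈ B, z - p ≠ 0 := fun z hz p hp h ↦
    Set.disjoint_left.1 hSB (subset_closure hz) (by rwa [sub_eq_zero.1 h])
  refine hB.induction₂ (fun q q' ↦ ∃ l : ℂ → ℂ, ContinuousOn l S ∧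
    ∀ z ∈ S, Complex.exp (l z) = (z - q) / (z - q')) ?_ ?_ ?_ hq hq'
  · intro x hx
    have hxS : x ∉ closure S := fun h ↦ Set.disjoint_left.1 hSB h hx
    obtain ⟨ε, hε, hball⟩ := Metric.isOpen_iff.1 isClosed_closure.isOpen_compl x hxS
    filter_upwards [self_mem_nhdsWithin, mem_nhdsWithin_of_mem_nhds (Metric.ball_mem_nhds x hε)]
      with y hy hyx
    -- When `y` is closer to `x` than `S` is, this ratio lies within distance 1 of 1, so the
    -- principal logarithm applies. Connectedness of `B` chains these local steps.
    have hz : ∀ z ∈ S, (z - y) / (z - x) ∈ slitPlane := by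
      intro z hz
      have h1 : ε ≤ ‖z - x‖ := by
        by_contra! h
        exact hball (by simpa [dist_eq_norm] using h) (subset_closure hz)
      have h2 : (z - y) / (z - x) = 1 + (x - y) / (z - x) := by
        field_simp [hne z hz x hx]
        ring
      rw [h2]
      apply Complex.mem_slitPlane_of_norm_lt_one
      rw [norm_div, div_lt_one (by linarith)]
      rw [Metric.mem_ball, dist_comm, dist_eq_norm] at hyx
      linarith
    refine ⟨fun z ↦ -Complex.log ((z - y) / (z - x)), ?_, fun z hzS ↦ ?_⟩
    · refine (ContinuousOn.clog ?_ hz).neg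
      exact (by fun_prop : ContinuousOn (fun z ↦ z - y) S).div (by fun_prop)
        fun z hz ↦ hne z hz x hx
    · rw [Complex.exp_neg, Complex.exp_log (Complex.slitPlane_ne_zero (hz z hzS)), inv_div]
  · rintro x y w hx hy hw ⟨l, hl, hl'⟩ ⟨m, hm, hm'⟩
    refine ⟨fun z ↦ l z + m z, hl.add hm, fun z hz ↦ ?_⟩
    rw [Complex.exp_add, hl' z hz, hm' z hz]
    field_simp [hne z hz y hy, hne z hz w hw]
  · rintro x y hx hy ⟨l, hl, hl'⟩
    refine ⟨fun z ↦ -l z, hl.neg, fun z hz ↦ ?_⟩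
    rw [Complex.exp_neg, hl' z hz, inv_div]

theorem isDiscrete_setOf_exp_eq_one : IsDiscrete {z : ℂ | Complex.exp z = 1} := by
  rw [isDiscrete_iff_forall_mem_exists_isOpen]
  intro z hz
  refine ⟨Metric.ball z 1, Metric.isOpen_ball, ?_⟩
  ext w
  simp only [mem_inter_iff, mem_ofPred_eq, mem_singleton_iff, Metric.mem_ball]
  refine ⟨fun ⟨h1, h2⟩ ↦ ?_, by rintro rfl; exact ⟨by simp, hz⟩⟩
  have h3 : Complex.exp (w - z) = 1 := by rw [Complex.exp_sub, h2, hz]; simp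
  obtain ⟨n, hn⟩ := Complex.exp_eq_one_iff.1 h3
  rw [dist_eq_norm, hn] at h1
  have h4 : ‖(n : ℂ) * (2 * Real.pi * I)‖ = |(n : ℝ)| * (2 * Real.pi) := by
    simp [abs_of_pos Real.pi_pos]
  rw [h4] at h1
  have h5 : |(n : ℝ)| < 1 := by nlinarith [Real.pi_gt_three, abs_nonneg (n : ℝ)]
  have h6 : n = 0 := by
    rw [← Int.cast_abs] at h5
    exact Int.abs_lt_one_iff.1 (by exact_mod_cast h5)
  rw [h6] at hn
  simpa [sub_eq_zero] using hn

/-- Two connected plane sets cannot alternate around a common boundary point if one stays away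
from the closure of the other. -/
theorem not_alternating_rays {A B : Set ℂ} {c : ℂ} (hA : IsPreconnected A)
    (hB : IsPreconnected B) (hAB : Disjoint (closure A) B) (hcA : c ∉ A) (hcB : c ∉ B)
    {θ α r : ℝ} (hα : 0 < α) (hα' : 3 * α < 2 * Real.pi) (hr : 0 < r)
    (h0 : ∀ t : ℝ, 0 < t → t ≤ r → c + t * Complex.exp (θ * I) ∈ A)
    (h1 : ∀ t : ℝ, 0 < t → t ≤ r → c + t * Complex.exp ((θ + α : ℝ) * I) ∈ B)
    (h2 : ∀ t : ℝ, 0 < t → t ≤ r → c + t * Complex.exp ((θ + 2 * α : ℝ) * I) ∈ A)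
    (h3 : ∀ t : ℝ, 0 < t → t ≤ r → c + t * Complex.exp ((θ + 3 * α : ℝ) * I) ∈ B) : False := by
  have hdis : ∀ z ∈ A, z ∉ B := fun z hz ↦ Set.disjoint_left.1 hAB (subset_closure hz)
  have hcl : Disjoint (closure (insert c A)) B := by
    rw [Set.insert_eq, closure_union, closure_singleton, disjoint_union_left]
    exact ⟨by simpa using hcB, hAB⟩
  -- A first logarithm, continuous even at `c`: both base points are tips of rays in `B`, and `B` is
  -- connected.
  obtain ⟨l, hl, hl'⟩ := exists_continuousOn_log_div hB hcl (h1 r hr le_rfl) (h3 r hr le_rfl)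
  -- A value in `(-∞, 0]` would put `z` on the segment from `c` to `c + r * u`, which lies in `B`
  -- apart from `c`.
  have hslit : ∀ u : ℂ, (∀ t : ℝ, 0 < t → t ≤ r → c + t * u ∈ B) → ∀ z ∈ A,
      1 - r * u / (z - c) ∈ slitPlane := by
    intro u hu z hz
    by_contra hcon
    have hzc : z - c ≠ 0 := fun h ↦ hcA (by rwa [← sub_eq_zero.1 h])
    rw [Complex.mem_slitPlane_iff_not_le_zero, not_not, Complex.le_def] at hcon
    obtain ⟨hre, him⟩ := hcon
    set s := r * u / (z - c) with hs
    simp only [sub_re, one_re, zero_re, sub_im, one_im, zero_im, zero_sub] at hre him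
    have hs' : s = (s.re : ℂ) := by
      apply Complex.ext <;> simp
      linarith
    have hs0 : (s.re : ℂ) ≠ 0 := by
      have : s.re ≠ 0 := by linarith
      exact_mod_cast this
    have hz' : z = c + ((r / s.re : ℝ) : ℂ) * u := by
      have : (s.re : ℂ) * (z - c) = r * u := by
        rw [← hs', hs]; field_simp
      push_cast
      field_simp
      linear_combination this
    refine hdis z hz ?_
    rw [hz']
    refine hu _ (div_pos hr (by linarith)) ?_
    rw [div_le_iff₀ (by linarith)]
    nlinarith
  set u1 := Complex.exp ((θ + α : ℝ) * I) with hu1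
  set u3 := Complex.exp ((θ + 3 * α : ℝ) * I) with hu3
  -- A second logarithm of the same ratio, with cuts along the two segments in `B`. On the connected
  -- set `A` it differs from `l` by a constant, but its limit at `c` depends on the sector of
  -- approach.
  let L : ℂ → ℂ := fun z ↦
    Complex.log (1 - r * u1 / (z - c)) - Complex.log (1 - r * u3 / (z - c))
  have hcont : ∀ u : ℂ, ContinuousOn (fun z ↦ 1 - r * u / (z - c)) A := fun u ↦
    continuousOn_const.sub (continuousOn_const.div (by fun_prop)
      fun z hz h ↦ hcA (by rwa [← sub_eq_zero.1 h]))
  have hL : ContinuousOn L A :=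
    ((hcont u1).clog (hslit u1 h1)).sub ((hcont u3).clog (hslit u3 h3))
  have hLexp : ∀ z ∈ A, Complex.exp (L z) = (z - (c + r * u1)) / (z - (c + r * u3)) := by
    intro z hz
    have hzc : z - c ≠ 0 := fun h ↦ hcA (by rwa [← sub_eq_zero.1 h])
    have e1 := Complex.slitPlane_ne_zero (hslit u1 h1 z hz)
    have e3 := Complex.slitPlane_ne_zero (hslit u3 h3 z hz)
    have e4 : z - (c + r * u3) = (z - c) * (1 - r * u3 / (z - c)) := by field_simp; ring
    have e5 : z - (c + r * u1) = (z - c) * (1 - r * u1 / (z - c)) := by field_simp; ring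
    rw [Complex.exp_sub, Complex.exp_log e1, Complex.exp_log e3, e4, e5,
      mul_div_mul_left _ _ hzc]
  have hmaps : MapsTo (fun z ↦ L z - l z) A {z : ℂ | Complex.exp z = 1} := by
    intro z hz
    have := Complex.exp_ne_zero (l z)
    rw [mem_ofPred_eq, Complex.exp_sub, hLexp z hz, ← hl' z (mem_insert_of_mem _ hz), div_self this]
  have hconst := fun t (ht : 0 < t) (htr : t ≤ r) ↦
    hA.constant_of_mapsTo isDiscrete_setOf_exp_eq_one (hL.sub (hl.mono (subset_insert _ _))) hmaps
      (h0 t ht htr) (h2 t ht htr)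
  have hsmall : ∀ᶠ t : ℝ in 𝓝[>] 0, 0 < t ∧ t ≤ r := by
    filter_upwards [self_mem_nhdsWithin, mem_nhdsWithin_of_mem_nhds (Iic_mem_nhds hr)] with t a b
    exact ⟨a, b⟩
  have hlim : ∀ u : ℂ, (∀ t : ℝ, 0 < t → t ≤ r → c + t * u ∈ A) →
      Tendsto (fun t : ℝ ↦ l (c + t * u)) (𝓝[>] 0) (𝓝 (l c)) := by
    intro u hu
    refine (hl c (mem_insert _ _)).tendsto.comp ?_
    rw [tendsto_nhdsWithin_iff]
    constructor
    · have : Continuous fun t : ℝ ↦ c + t * u := by fun_prop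
      simpa using (this.tendsto 0).mono_left nhdsWithin_le_nhds
    · filter_upwards [hsmall] with t ht
      exact mem_insert_of_mem _ (hu t ht.1 ht.2)
  have hzero := ((hlim _ h0).sub (hlim _ h2))
  rw [sub_self] at hzero
  have hzero := (Complex.continuous_im.tendsto _).comp hzero
  have hexp : ∀ a b : ℝ, Complex.exp (a * I) / Complex.exp (b * I)
      = Complex.exp ((a - b : ℝ) * I) := by
    intro a b
    rw [← Complex.exp_sub]; push_cast; ring_nf
  have hLlim : ∀ ψ β β' : ℝ, 0 < β → β < 2 * Real.pi → 0 < β' → β' < 2 * Real.pi →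
      u1 / Complex.exp (ψ * I) = Complex.exp (β * I) →
      u3 / Complex.exp (ψ * I) = Complex.exp (β' * I) →
      Tendsto (fun t : ℝ ↦ (L (c + t * Complex.exp (ψ * I))).im) (𝓝[>] 0)
        (𝓝 ((β - Real.pi) - (β' - Real.pi))) := by
    intro ψ β β' hβ hβ2 hβ' hβ2' e1 e3
    refine ((tendsto_arg_one_sub_div hβ hβ2 hr).sub (tendsto_arg_one_sub_div hβ' hβ2' hr)).congr ?_
    intro t
    simp only [L, sub_im, log_im, add_sub_cancel_left, ← e1, ← e3]
    push_cast
    congr 3 <;> rw [div_mul_div_comm]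
  -- The imaginary part of `L` tends to `-2α` along the first ray of `A` and to `2π - 2α` along the
  -- second, whereas `l` has a single limit at `c`. This forces `-2π = 0`.
  have lim0 := hLlim θ α (3 * α) hα (by linarith) (by linarith) hα'
    (by rw [hu1, hexp]; congr 3; ring) (by rw [hu3, hexp]; congr 3; ring)
  have lim2 := hLlim (θ + 2 * α) (2 * Real.pi - α) α (by linarith [Real.pi_pos]) (by linarith) hα
    (by linarith [Real.pi_pos])
    (by rw [hu1, hexp, Complex.exp_eq_exp_iff_exists_int]
        exact ⟨-1, by push_cast; ring⟩) (by rw [hu3, hexp]; congr 3; ring)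
  have hd := lim0.sub lim2
  have hEq : ∀ᶠ t : ℝ in 𝓝[>] 0, (L (c + t * Complex.exp (θ * I))).im
      - (L (c + t * Complex.exp ((θ + 2 * α : ℝ) * I))).im =
      (l (c + t * Complex.exp (θ * I)) - l (c + t * Complex.exp ((θ + 2 * α : ℝ) * I))).im := by
    filter_upwards [hsmall] with t ht
    have := hconst t ht.1 ht.2
    simp only [Pi.sub_apply] at this
    rw [← sub_im]
    congr 1
    linear_combination this
  have := tendsto_nhds_unique (hd.congr' hEq) hzero
  simp only [zero_im] at this
  linarith [Real.pi_pos]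

/-! ### Harmonic functions: isometry invariance, maximum principle, critical points. -/

section Isometry

variable {E E' G : Type*} [NormedAddCommGroup E] [InnerProductSpace ℝ E] [FiniteDimensional ℝ E]
  [NormedAddCommGroup E'] [InnerProductSpace ℝ E'] [FiniteDimensional ℝ E']
  [NormedAddCommGroup G] [NormedSpace ℝ G]

/-- The Laplacian can be computed in any orthonormal basis, and an isometry carries one such basis
to another. This lets complex analysis on `ℂ` be used in the Euclidean plane. -/
theorem InnerProductSpace.laplacian_comp_linearIsometryEquiv (f : E' → G) (e : E ≃ₗᵢ[ℝ] E') :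
    Laplacian.laplacian (f ∘ e) = Laplacian.laplacian f ∘ e := by
  ext x
  rw [laplacian_eq_iteratedFDeriv_orthonormalBasis _ (stdOrthonormalBasis ℝ E),
    laplacian_eq_iteratedFDeriv_orthonormalBasis _ ((stdOrthonormalBasis ℝ E).map e)]
  have h := e.toContinuousLinearEquiv.iteratedFDerivWithin_comp_right (𝕜 := ℝ) f
    uniqueDiffOn_univ (x := x) (mem_univ _) 2
  simp only [preimage_univ, iteratedFDerivWithin_univ] at h
  have h' : iteratedFDeriv ℝ 2 (f ∘ e) x = _ := h
  simp only [h', Function.comp_apply]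
  refine Finset.sum_congr rfl fun i _ ↦ ?_
  rw [ContinuousMultilinearMap.compContinuousLinearMap_apply]
  simp only [LinearIsometryEquiv.coe_toContinuousLinearEquiv, OrthonormalBasis.map_apply]
  congr 1
  ext j
  fin_cases j <;> rfl

theorem InnerProductSpace.HarmonicAt.comp_linearIsometryEquiv {f : E' → G} {e : E ≃ₗᵢ[ℝ] E'}
    {x : E} (h : HarmonicAt f (e x)) : HarmonicAt (f ∘ e) x := by
  refine ⟨h.1.comp x e.contDiff.contDiffAt, ?_⟩
  rw [laplacian_comp_linearIsometryEquiv]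
  exact e.continuous.continuousAt.eventually h.2

end Isometry

theorem InnerProductSpace.HarmonicAt.exists_analyticAt_re_eq {h : ℂ → ℝ} {c : ℂ}
    (hh : HarmonicAt h c) : ∃ g : ℂ → ℂ, AnalyticAt ℂ g c ∧ ∀ᶠ z in 𝓝 c, h z = (g z).re := by
  obtain ⟨ε, h₁ε, h₂ε⟩ := Metric.isOpen_iff.1 (isOpen_setOfPred_harmonicAt (f := h)) c hh
  obtain ⟨F, h₁F, h₂F⟩ := InnerProductSpace.HarmonicOnNhd.exists_analyticOnNhd_ball_re_eq
    (fun _ hy ↦ h₂ε hy)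
  exact ⟨F, h₁F c (Metric.mem_ball_self h₁ε),
    eventually_of_mem (Metric.ball_mem_nhds c h₁ε) fun z hz ↦ (h₂F hz).symm⟩

/-- If `h = Re g` locally, then `exp g` has modulus `exp h`, and the maximum modulus principle
applies to it. -/
theorem InnerProductSpace.HarmonicAt.eventually_eq_of_isLocalMax {h : ℂ → ℝ} {c : ℂ}
    (hh : HarmonicAt h c) (hmax : IsLocalMax h c) : ∀ᶠ z in 𝓝 c, h z = h c := by
  obtain ⟨g, hg, hgh⟩ := hh.exists_analyticAt_re_eq
  have hc := hgh.self_of_nhds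
  have hd : ∀ᶠ z in 𝓝 c, DifferentiableAt ℂ (fun z ↦ Complex.exp (g z)) z := by
    filter_upwards [hg.eventually_analyticAt] with z hz
    exact hz.differentiableAt.cexp
  have hm : IsLocalMax (norm ∘ fun z ↦ Complex.exp (g z)) c := by
    filter_upwards [hmax, hgh] with z h1 h2
    simp only [Function.comp_apply, Complex.norm_exp, Real.exp_le_exp]
    rw [← h2, ← hc]
    exact h1
  filter_upwards [Complex.eventually_eq_of_isLocalMax_norm hd hm, hgh] with z h1 h2
  have := congrArg norm h1
  simp only [Complex.norm_exp, Real.exp_eq_exp] at this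
  rw [h2, hc, this]

theorem InnerProductSpace.HarmonicOnNhd.eqOn_const_of_eventuallyEq {h : ℂ → ℝ} {U : Set ℂ}
    (hh : HarmonicOnNhd h U) (hU : IsPreconnected U) {c : ℂ} {a : ℝ} (hc : c ∈ U)
    (he : ∀ᶠ z in 𝓝 c, h z = a) : ∀ z ∈ U, h z = a :=
  AnalyticOnNhd.eqOn_of_preconnected_of_eventuallyEq (𝕜 := ℝ) (f := h) (g := fun _ ↦ a)
    (fun z hz ↦ HarmonicAt.analyticAt (hh z hz)) analyticOnNhd_const hU hc he

/-- Around a critical point, a nonconstant harmonic function takes values that are alternately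
larger and smaller on four rays. -/
theorem InnerProductSpace.HarmonicAt.exists_alternating_rays {h : ℂ → ℝ} {c : ℂ}
    (hh : HarmonicAt h c) (hcrit : fderiv ℝ h c = 0) (hnc : ¬ ∀ᶠ z in 𝓝 c, h z = h c)
    {U : Set ℂ} (hU : U ∈ 𝓝 c) :
    ∃ θ α r : ℝ, 0 < α ∧ 3 * α < 2 * Real.pi ∧ 0 < r ∧ ∀ t : ℝ, 0 < t → t ≤ r → ∀ j : ℕ,
      c + t * Complex.exp ((θ + j * α : ℝ) * I) ∈ U ∧
      0 < (-1) ^ j * (h (c + t * Complex.exp ((θ + j * α : ℝ) * I)) - h c) := by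
  obtain ⟨g, hg, hgh⟩ := hh.exists_analyticAt_re_eq
  have hc := hgh.self_of_nhds
  have hg0 : AnalyticAt ℂ (fun z ↦ g z - g c) c := hg.sub analyticAt_const
  obtain ⟨m, k, hk, hk0, hgk⟩ := hg0.exists_eventuallyEq_pow_smul_nonzero_iff.2 (by
    intro hcon
    apply hnc
    filter_upwards [hcon, hgh] with z h1 h2
    rw [h2, hc, sub_eq_zero.1 h1])
  have hderiv : deriv g c = 0 := by
    have h1 := (reCLM.hasFDerivAt.comp c
      (hg.differentiableAt.hasDerivAt.hasFDerivAt.restrictScalars ℝ)).congr_of_eventuallyEq hgh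
    rw [h1.fderiv] at hcrit
    have a1 := DFunLike.congr_fun hcrit 1
    have a2 := DFunLike.congr_fun hcrit I
    simp at a1 a2
    exact Complex.ext a1 a2
  have hm : 2 ≤ m := by
    by_contra! hlt
    interval_cases m
    · have := hgk.self_of_nhds
      simp at this
      exact hk0 this.symm
    · have h1 : HasDerivAt (fun z ↦ (z - c) ^ 1 • k z) (k c) c := by
        have := ((hasDerivAt_id c).sub_const c).mul hk.differentiableAt.hasDerivAt
        simpa using! this
      have h2 := (h1.congr_of_eventuallyEq hgk).deriv
      simp only [deriv_sub_const] at h2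
      exact hk0 (h2.symm.trans hderiv)
  have hm0 : (0 : ℝ) < m := by positivity
  have hm2 : (2 : ℝ) ≤ m := by exact_mod_cast hm
  -- Rotating by the argument of `k c` makes the factor `k` positive at `c`, hence of positive real
  -- part nearby.
  have hpos : ∀ᶠ z in 𝓝 c, 0 < (Complex.exp (-((k c).arg * I)) * k z).re := by
    have hcont : ContinuousAt (fun z ↦ (Complex.exp (-((k c).arg * I)) * k z).re) c :=
      Complex.continuous_re.continuousAt.comp (continuousAt_const.mul hk.continuousAt)
    refine hcont.eventually (lt_mem_nhds ?_)
    have : Complex.exp (-((k c).arg * I)) * k c = (‖k c‖ : ℂ) := by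
      nth_rw 2 [← Complex.norm_mul_exp_arg_mul_I (k c)]
      rw [mul_left_comm, ← Complex.exp_add]
      simp
    simp only [this]
    simpa using hk0
  obtain ⟨r, hr, hball⟩ := Metric.nhds_basis_closedBall.mem_iff.1
    (Filter.inter_mem (Filter.inter_mem hU hgh) (Filter.inter_mem hgk hpos))
  -- Along these directions the `m`-th power cancels the argument of `k c` and contributes the sign
  -- `(-1) ^ j`. Since `m ≥ 2`, four rays fit within one turn.
  refine ⟨-(k c).arg / m, Real.pi / m, r, by positivity, ?_, hr, fun t ht htr j ↦ ?_⟩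
  · rw [mul_div_assoc', div_lt_iff₀ hm0]
    nlinarith [Real.pi_pos]
  set w := Complex.exp ((-(k c).arg / m + j * (Real.pi / m) : ℝ) * I) with hw
  have hwn : ‖w‖ = 1 := Complex.norm_exp_ofReal_mul_I _
  have hmem : c + t * w ∈ Metric.closedBall c r := by
    simp [dist_eq_norm, hwn, abs_of_pos ht, htr]
  obtain ⟨⟨hzU, h1⟩, h2, h3⟩ := hball hmem
  refine ⟨hzU, ?_⟩
  have h1 : h (c + t * w) = (g (c + t * w)).re := h1
  have h2 : g (c + t * w) - g c = (c + t * w - c) ^ m • k (c + t * w) := h2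
  have h3 : 0 < (Complex.exp (-((k c).arg * I)) * k (c + t * w)).re := h3
  have hwm : w ^ m = (-1) ^ j * Complex.exp (-((k c).arg * I)) := by
    rw [hw, ← Complex.exp_nat_mul, ← Complex.exp_pi_mul_I, ← Complex.exp_nat_mul,
      ← Complex.exp_add]
    congr 1
    have : (m : ℂ) ≠ 0 := by exact_mod_cast hm0.ne'
    push_cast
    field_simp
    ring
  have h4 : h (c + t * w) - h c =
      t ^ m * ((-1) ^ j * (Complex.exp (-((k c).arg * I)) * k (c + t * w)).re) := by
    rw [h1, hc, ← Complex.sub_re, h2, add_sub_cancel_left, mul_pow, hwm]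
    have : ((t : ℂ) ^ m * ((-1) ^ j * Complex.exp (-((k c).arg * I)))) • k (c + t * w) =
      ((t ^ m * (-1) ^ j : ℝ) : ℂ) * (Complex.exp (-((k c).arg * I)) * k (c + t * w)) := by
      push_cast; rw [smul_eq_mul]; ring
    rw [this, Complex.re_ofReal_mul, mul_assoc]
  have h5 : ((-1 : ℝ) ^ j) * (-1) ^ j = 1 := by rw [← mul_pow]; simp
  rw [h4]
  have : (-1 : ℝ) ^ j * (t ^ m * ((-1) ^ j * (Complex.exp (-((k c).arg * I)) * k (c + t * w)).re))
    = t ^ m * (Complex.exp (-((k c).arg * I)) * k (c + t * w)).re := by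
    linear_combination (t ^ m * (Complex.exp (-((k c).arg * I)) * k (c + t * w)).re) * h5
  rw [this]
  positivity

/-! ### From connected boundary traces to absence of critical points. -/

/-- By the maximum principle, a superlevel set is connected if its trace on the boundary is. -/
theorem isPreconnected_superlevel_of_frontier {K : Set ℂ} (hK : IsCompact K) {h : ℂ → ℝ}
    (hcont : ContinuousOn h K) (hh : HarmonicOnNhd h (interior K))
    (hU : IsPreconnected (interior K)) {a : ℝ} (ha : ∃ z ∈ interior K, h z ≤ a)
    (hfr : IsPreconnected {z ∈ frontier K | a < h z}) : IsPreconnected {z ∈ K | a < h z} := by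
  have key : ∀ u v : Set ℂ, IsOpen u → IsOpen v → {z ∈ K | a < h z} ⊆ u ∪ v →
      {z ∈ K | a < h z} ∩ (u ∩ v) = ∅ → {z ∈ frontier K | a < h z} ⊆ u →
      {z ∈ K | a < h z} ⊆ u := by
    intro u v hu hv huv hdis hfu
    by_contra hcon
    obtain ⟨z₁, ⟨hz₁K, hz₁⟩, hz₁u⟩ := Set.not_subset.1 hcon
    have hz₁v : z₁ ∈ K \ u := ⟨hz₁K, hz₁u⟩
    -- A piece of the superlevel set missing the boundary would contain an interior local maximum,
    -- making `h` constant and above `a`, contrary to `ha`.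
    obtain ⟨y, hy, hymax⟩ := (hK.diff hu).exists_isMaxOn ⟨z₁, hz₁v⟩ (hcont.mono sdiff_subset)
    have hya : a < h y := hz₁.trans_le (hymax hz₁v)
    have hyv : y ∈ v := (huv ⟨hy.1, hya⟩).resolve_left hy.2
    have hyint : y ∈ interior K := by
      by_contra hni
      exact hy.2 (hfu ⟨⟨subset_closure hy.1, hni⟩, hya⟩)
    have hlm : IsLocalMax h y := by
      have hev : ∀ᶠ z in 𝓝 y, a < h z :=
        (hcont.continuousAt (mem_interior_iff_mem_nhds.1 hyint)).eventually (lt_mem_nhds hya)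
      filter_upwards [hv.mem_nhds hyv, mem_interior_iff_mem_nhds.1 hyint, hev] with z hzv hzK hza
      exact hymax ⟨hzK, fun hzu ↦ by
        have : z ∈ {z ∈ K | a < h z} ∩ (u ∩ v) := ⟨⟨hzK, hza⟩, hzu, hzv⟩
        rw [hdis] at this
        exact this⟩
    have hconst := hh.eqOn_const_of_eventuallyEq hU hyint
      ((hh y hyint).eventually_eq_of_isLocalMax hlm)
    obtain ⟨z, hz, hza⟩ := ha
    linarith [hconst z hz]
  rw [isPreconnected_iff_subset_of_disjoint] at hfr ⊢
  intro u v hu hv huv hdis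
  have hsub : {z ∈ frontier K | a < h z} ⊆ {z ∈ K | a < h z} := fun z hz ↦
    ⟨hK.isClosed.frontier_subset hz.1, hz.2⟩
  rcases hfr u v hu hv (hsub.trans huv) (subset_empty_iff.1 (hdis ▸ inter_subset_inter_left _ hsub))
    with h1 | h1
  · exact Or.inl (key u v hu hv huv hdis h1)
  · exact Or.inr (key v u hv hu (by rwa [union_comm]) (by rwa [inter_comm v u]) h1)

/-- A harmonic function whose boundary values cross a level only along two complementary arcs has
no critical point on that level. -/
theorem fderiv_ne_zero_of_isPreconnected_frontier {K : Set ℂ} (hK : IsCompact K) {h : ℂ → ℝ}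
    (hcont : ContinuousOn h K) (hh : HarmonicOnNhd h (interior K))
    (hU : IsPreconnected (interior K)) {c : ℂ} (hc : c ∈ interior K)
    (hnc : ∃ z ∈ interior K, h z ≠ h c)
    (hgt : IsPreconnected {z ∈ frontier K | h c < h z})
    (hlt : IsPreconnected {z ∈ frontier K | h z < h c}) : fderiv ℝ h c ≠ 0 := by
  intro hcrit
  have hA := isPreconnected_superlevel_of_frontier hK hcont hh hU ⟨c, hc, le_rfl⟩ hgt
  have hB := isPreconnected_superlevel_of_frontier hK hcont.neg hh.neg hU
    (a := -h c) ⟨c, hc, le_rfl⟩ (by simpa using hlt)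
  simp only [Pi.neg_apply, neg_lt_neg_iff] at hB
  have hcl : closure {z ∈ K | h c < h z} ⊆ {z ∈ K | h c ≤ h z} :=
    closure_minimal (fun z hz ↦ ⟨hz.1, hz.2.le⟩)
      (hcont.preimage_isClosed_of_isClosed hK.isClosed isClosed_Ici)
  obtain ⟨θ, α, r, hα, hα', hr, hrays⟩ := (hh c hc).exists_alternating_rays hcrit
    (fun hev ↦ by
      obtain ⟨z, hz, hne⟩ := hnc
      exact hne (hh.eqOn_const_of_eventuallyEq hU hc hev z hz))
    (mem_interior_iff_mem_nhds.1 hc)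
  refine not_alternating_rays hA hB (c := c) ?_ (by simp) (by simp) hα hα' hr
    (θ := θ) ?_ ?_ ?_ ?_
  · exact Set.disjoint_left.2 fun z hz hz' ↦ absurd (hcl hz).2 (not_le.2 hz'.2)
  all_goals
    intro t ht htr
  · have := hrays t ht htr 0
    simpa using! this
  · have := hrays t ht htr 1
    simpa using! this
  · have := hrays t ht htr 2
    simpa using! this
  · have := hrays t ht htr 3
    refine ⟨this.1, ?_⟩
    have := this.2
    norm_num at this
    simpa using this

end

section

open Filter Topology

/-! ### Boundaries of convex bodies. -/

section Convex

variable {E : Type*} [NormedAddCommGroup E] [NormedSpace ℝ E]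

/-- The part of the boundary of a convex body on one side of a hyperplane through an interior
point is the image of an open half-space under radial projection. -/
theorem Convex.exists_radial_projection {W : Set E} (hW : Convex ℝ W)
    (hb : Bornology.IsBounded W) {w : E} (hw : w ∈ interior W) :
    ∃ p : E → E, ContinuousOn p {0}ᶜ ∧ (∀ v ≠ 0, p v ∈ frontier W) ∧
      (∀ v ≠ 0, ∃ s : ℝ, 0 < s ∧ p v = w + s • v) ∧ ∀ y ∈ frontier W, p (y - w) = y := by
  set S : Set E := (w + ·) ⁻¹' W with hS
  have hS0 : S ∈ 𝓝 0 := by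
    refine (continuous_const_add w).continuousAt.preimage_mem_nhds ?_
    simpa using mem_interior_iff_mem_nhds.1 hw
  have hSc : Convex ℝ S := hW.translate_preimage_right w
  have hSb : Bornology.IsVonNBounded ℝ S := by
    rw [NormedSpace.isVonNBounded_iff]
    have : S = (fun x ↦ -w + x) '' W := by
      rw [image_add_left]; simp [hS]
    rw [this]
    exact (hb.vadd (-w))
  have hfr : ∀ v, v ∈ frontier S ↔ w + v ∈ frontier W := fun v ↦ by
    have := (Homeomorph.addLeft w).preimage_frontier W
    exact (Set.ext_iff.1 this v).symm
  have hpos : ∀ v ≠ 0, 0 < gauge S v := fun v hv ↦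
    (gauge_pos (absorbent_nhds_zero hS0) hSb).2 hv
  -- The frontier of the translated body is the unit level of its Minkowski gauge.
  refine ⟨fun v ↦ w + (gauge S v)⁻¹ • v, ?_, ?_, ?_, ?_⟩
  · refine continuousOn_const.add (ContinuousOn.smul
      ((continuous_gauge hSc hS0).continuousOn.inv₀ fun v hv ↦ (hpos v hv).ne') continuousOn_id)
  · intro v hv
    rw [← hfr, ← gauge_eq_one_iff_mem_frontier hSc hS0,
      gauge_smul_of_nonneg (inv_nonneg.2 (hpos v hv).le), smul_eq_mul,
      inv_mul_cancel₀ (hpos v hv).ne']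
  · exact fun v hv ↦ ⟨_, inv_pos.2 (hpos v hv), rfl⟩
  · intro y hy
    have : gauge S (y - w) = 1 := by
      rw [gauge_eq_one_iff_mem_frontier hSc hS0, hfr]
      simpa using hy
    simp [this]

theorem Convex.isPreconnected_frontier_inter_halfSpace {W : Set E} (hW : Convex ℝ W)
    (hb : Bornology.IsBounded W) {w : E} (hw : w ∈ interior W) (l : E →L[ℝ] ℝ) :
    IsPreconnected {y ∈ frontier W | l w < l y} := by
  obtain ⟨p, hp, hpf, hps, hpr⟩ := hW.exists_radial_projection hb hw
  have h0 : ∀ v, 0 < l v → v ≠ 0 := by rintro v hv rfl; simp at hv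
  have himg : {y ∈ frontier W | l w < l y} = p '' {v | 0 < l v} := by
    ext y
    constructor
    · rintro ⟨hy, hly⟩
      exact ⟨y - w, by simpa using hly, hpr y hy⟩
    · rintro ⟨v, hv, rfl⟩
      obtain ⟨s, hs, hpv⟩ := hps v (h0 v hv)
      refine ⟨hpf v (h0 v hv), ?_⟩
      rw [hpv, map_add, map_smul, smul_eq_mul]
      have : 0 < l v := hv
      nlinarith [mul_pos hs this]
  rw [himg]
  exact (convex_halfSpace_gt l.isLinear 0).isPreconnected.image _
    (hp.mono fun v hv ↦ h0 v hv)

theorem Convex.exists_mem_frontier_lt {W : Set E} (hW : Convex ℝ W)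
    (hb : Bornology.IsBounded W) {w : E} (hw : w ∈ interior W) {l : E →L[ℝ] ℝ} (hl : l ≠ 0) :
    ∃ y ∈ frontier W, l w < l y := by
  obtain ⟨p, -, hpf, hps, -⟩ := hW.exists_radial_projection hb hw
  obtain ⟨v, hv⟩ : ∃ v, l v ≠ 0 := by
    by_contra! h
    exact hl (ContinuousLinearMap.ext h)
  obtain ⟨v, hv⟩ : ∃ v, 0 < l v := by
    rcases hv.lt_or_gt with h | h
    · exact ⟨-v, by simpa using h⟩
    · exact ⟨v, h⟩
  have h0 : v ≠ 0 := by rintro rfl; simp at hv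
  obtain ⟨s, hs, hpv⟩ := hps v h0
  refine ⟨p v, hpf v h0, ?_⟩
  rw [hpv, map_add, map_smul, smul_eq_mul]
  nlinarith [mul_pos hs hv]

end Convex

/-! ### From local to global injectivity. -/

/-- A local homeomorphism from a connected space to a simply connected one that is closed with
compact fibers is bijective. -/
theorem IsLocalHomeomorph.bijective_of_isClosedMap {X Y : Type*} [TopologicalSpace X]
    [TopologicalSpace Y] [T2Space X] [ConnectedSpace X] [SimplyConnectedSpace Y]
    [LocallyPathConnectedSpace Y] {p : X → Y} (hp : IsLocalHomeomorph p) (hc : IsClosedMap p)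
    (hf : ∀ y, IsCompact (p ⁻¹' {y})) : Function.Bijective p := by
  have hfin : ∀ y ∈ univ, (p ⁻¹' {y}).Finite := fun y _ ↦
    (hf y).finite (IsDiscrete.of_openPartialHomeomorph p subset_rfl fun e _ ↦ by
      obtain ⟨φ, hφ, h⟩ := hp e
      exact ⟨φ, hφ, h.symm⟩)
  have hcov : IsCoveringMapOn p univ := hc.isCoveringMapOn_of_isLocalHomeomorphOn hfin
    fun x _ ↦ hp x
  let x₀ : X := Classical.arbitrary X
  -- Lifting the identity gives a section `G`; the set where `G ∘ p` is the identity is clopen and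
  -- contains `x₀`.
  obtain ⟨G, ⟨hG0, hG⟩, -⟩ := hcov.existsUnique_continuousMap_lifts (ContinuousMap.id Y)
    (a₀ := p x₀) (e₀ := x₀) rfl fun _ ↦ mem_univ _
  have hG' : ∀ y, p (G y) = y := fun y ↦ congrFun hG y
  have hcl : IsClosed {x | G (p x) = x} :=
    isClosed_eq (G.continuous.comp hp.continuous) continuous_id
  have hop : IsOpen {x | G (p x) = x} := by
    rw [isOpen_iff_mem_nhds]
    intro x hx
    obtain ⟨φ, hφ, rfl⟩ := hp x
    have h1 : ∀ᶠ z in 𝓝 x, G (φ z) ∈ φ.source := by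
      refine (G.continuous.comp hp.continuous).continuousAt.eventually
        (φ.open_source.mem_nhds ?_)
      simpa [show G (φ x) = x from hx] using hφ
    filter_upwards [h1, φ.open_source.mem_nhds hφ] with z hz hz'
    exact φ.injOn hz hz' (hG' _)
  have huniv := IsClopen.eq_univ ⟨hcl, hop⟩ ⟨x₀, hG0⟩
  have hinv : ∀ x, G (p x) = x := fun x ↦ by
    have : x ∈ {x | G (p x) = x} := huniv ▸ mem_univ x
    exact this
  exact ⟨Function.LeftInverse.injective hinv, Function.RightInverse.surjective hG'⟩

/-- A local homeomorphism between open sets that extends continuously to a compact set, mapping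
the rest of it outside the target, is bijective. -/
theorem bijOn_of_isLocalHomeomorphOn {E E' : Type*} [TopologicalSpace E] [T2Space E]
    [NormedAddCommGroup E'] [NormedSpace ℝ E'] {F : E → E'} {K U : Set E} {O : Set E'}
    (hK : IsCompact K) (hF : ContinuousOn F K) (hU : IsOpen U) (hUc : IsConnected U) (hUK : U ⊆ K)
    (hO : IsOpen O) (hOc : Convex ℝ O) (hm : MapsTo F U O) (hout : ∀ x ∈ K, x ∉ U → F x ∉ O)
    (hloc : IsLocalHomeomorphOn F U) : BijOn F U O := by
  have : ConnectedSpace U := isConnected_iff_connectedSpace.1 hUc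
  have : ContractibleSpace O := hOc.contractibleSpace (hUc.nonempty.image F |>.mono hm.image_subset)
  have : LocallyPathConnectedSpace O := hO.locallyPathConnectedSpace
  have hcont : Continuous (hm.restrict F U O) := (hF.mono hUK).mapsToRestrict hm
  have hlh : IsLocalHomeomorph (hm.restrict F U O) := by
    refine IsLocalHomeomorph.of_comp ?_ hO.isOpenEmbedding_subtypeVal.isLocalHomeomorph hcont
    have : Subtype.val ∘ hm.restrict F U O = F ∘ Subtype.val := rfl
    rw [this, isLocalHomeomorph_iff_isLocalHomeomorphOn_univ]
    refine hloc.comp (isLocalHomeomorph_iff_isLocalHomeomorphOn_univ.1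
      hU.isOpenEmbedding_subtypeVal.isLocalHomeomorph) fun x _ ↦ x.2
  have hclosed : IsClosedMap (hm.restrict F U O) := by
    intro C hC
    obtain ⟨C', hC', rfl⟩ := isClosed_induced_iff.1 hC
    -- Enlarging from `U` to the compact `K` adds no image points inside `O`, by `hout`.
    have h1 : IsClosed (F '' (K ∩ C')) :=
      ((hK.inter_right hC').image_of_continuousOn (hF.mono inter_subset_left)).isClosed
    convert h1.preimage continuous_subtype_val using 1
    ext y
    constructor
    · rintro ⟨x, hx, rfl⟩
      exact ⟨x, ⟨hUK x.2, hx⟩, rfl⟩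
    · rintro ⟨x, ⟨hxK, hxC⟩, hxy⟩
      have hxU : x ∈ U := by
        by_contra h
        exact hout x hxK h (hxy ▸ y.2)
      exact ⟨⟨x, hxU⟩, hxC, Subtype.ext hxy⟩
  have hcomp : ∀ y, IsCompact (hm.restrict F U O ⁻¹' {y}) := by
    intro y
    rw [Topology.IsEmbedding.subtypeVal.isCompact_iff]
    have : Subtype.val '' (hm.restrict F U O ⁻¹' {y}) = K ∩ F ⁻¹' {y.1} := by
      ext x
      constructor
      · rintro ⟨x, hx, rfl⟩
        exact ⟨hUK x.2, congrArg Subtype.val hx⟩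
      · rintro ⟨hxK, hxy⟩
        have hxy : F x = y := hxy
        have hxU : x ∈ U := by
          by_contra h
          exact hout x hxK h (hxy ▸ y.2)
        exact ⟨⟨x, hxU⟩, Subtype.ext hxy, rfl⟩
    rw [this]
    exact hK.of_isClosed_subset (hF.preimage_isClosed_of_isClosed hK.isClosed isClosed_singleton)
      inter_subset_left
  have hbij := hlh.bijective_of_isClosedMap hclosed hcomp
  refine ⟨hm, fun x hx y hy hxy ↦ ?_, fun y hy ↦ ?_⟩
  · exact congrArg Subtype.val (hbij.1 (a₁ := ⟨x, hx⟩) (a₂ := ⟨y, hy⟩) (Subtype.ext hxy))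
  · obtain ⟨x, hx⟩ := hbij.2 ⟨y, hy⟩
    exact ⟨x, x.2, congrArg Subtype.val hx⟩

/-- A continuous injection of a compact set into a Hausdorff space is closed. This pulls arcs of
`∂W` back to `∂V`. -/
theorem IsPreconnected.inter_preimage_of_injOn {X Y : Type*} [TopologicalSpace X]
    [TopologicalSpace Y] [T2Space Y] {F : X → Y} {K : Set X} {S : Set Y} (hS : IsPreconnected S)
    (hK : IsCompact K) (hF : ContinuousOn F K) (hinj : InjOn F K) (hsub : S ⊆ F '' K) :
    IsPreconnected (K ∩ F ⁻¹' S) := by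
  have : CompactSpace K := isCompact_iff_compactSpace.1 hK
  have hc : Continuous (K.domRestrict F) := continuousOn_iff_continuous_domRestrict.1 hF
  have h := hS.preimage_of_isClosedMap (f := K.domRestrict F) hinj.injective hc.isClosedMap
    (by rwa [range_domRestrict])
  have h' := h.image _ continuous_subtype_val.continuousOn
  convert h' using 1
  ext x
  simp [and_comm]

namespace HarmonicGBC

/-- The standard identification of `ℂ` with the Euclidean plane. -/
noncomputable def complexEquiv : ℂ ≃ₗᵢ[ℝ] Plane := Complex.orthonormalBasisOneI.repr

/-! ### The Radó–Kneser–Choquet theorem for a homeomorphic boundary map. -/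

section RadoKneserChoquet

variable {V W : Set Plane} {F : Plane → Plane}

theorem contDiffAt_of_harmonicAt {x : Plane} (h : HarmonicAt F x) : ContDiffAt ℝ ∞ F x := by
  rw [contDiffAt_euclidean]
  intro i
  have h1 : HarmonicAt ((EuclideanSpace.proj i : Plane →L[ℝ] ℝ) ∘ F)
      (complexEquiv (complexEquiv.symm x)) := by
    rw [LinearIsometryEquiv.apply_symm_apply]
    exact h.comp_CLM _
  have h2 : ContDiffAt ℝ ∞ _ _ := (HarmonicAt.analyticAt h1.comp_linearIsometryEquiv).contDiffAt
  have h3 := h2.comp x complexEquiv.symm.contDiff.contDiffAt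
  refine h3.congr_of_eventuallyEq (Eventually.of_forall fun y ↦ ?_)
  simp

variable (hV : IsCompact V) (hVc : IsConnected (interior V)) (hVcl : closure (interior V) = V)
  (hW : IsCompact W) (hWc : Convex ℝ W) (hWi : (interior W).Nonempty)
  (hF : ContinuousOn F V) (hFh : HarmonicOnNhd F (interior V))
  (hFb : BijOn F (frontier V) (frontier W))

include hV hVcl hW hWc hWi hF hFb in
-- Otherwise, by density of the interior, `l` would be constant on `∂W`, which has points strictly
-- on both sides of any line through an interior point of `W`.
theorem exists_mem_interior_apply_ne {l : Plane →L[ℝ] ℝ} (hl : l ≠ 0) (a : ℝ) :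
    ∃ z ∈ interior V, l (F z) ≠ a := by
  by_contra! h
  have h1 : EqOn (fun z ↦ l (F z)) (fun _ ↦ a) V :=
    EqOn.of_subset_closure (s := interior V) h (l.continuous.comp_continuousOn hF)
      continuousOn_const interior_subset hVcl.ge
  have h2 : ∀ y ∈ frontier W, l y = a := by
    intro y hy
    obtain ⟨x, hx, rfl⟩ := hFb.surjOn hy
    exact h1 (hV.isClosed.frontier_subset hx)
  obtain ⟨w, hw⟩ := hWi
  obtain ⟨y, hy, hly⟩ := hWc.exists_mem_frontier_lt hW.isBounded hw hl
  obtain ⟨z, hz, hlz⟩ := hWc.exists_mem_frontier_lt hW.isBounded hw (neg_ne_zero.2 hl)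
  simp only [neg_apply] at hlz
  linarith [h2 y hy, h2 z hz]

theorem mem_interior_preimage_complexEquiv {z : ℂ} :
    z ∈ interior (complexEquiv ⁻¹' V) ↔ complexEquiv z ∈ interior V := by
  have h : interior (complexEquiv ⁻¹' V) = complexEquiv ⁻¹' interior V :=
    (complexEquiv.toHomeomorph.preimage_interior V).symm
  rw [h, mem_preimage]

include hFh in
theorem harmonicOnNhd_comp_complexEquiv (l : Plane →L[ℝ] ℝ) :
    HarmonicOnNhd (fun z ↦ l (F (complexEquiv z))) (interior (complexEquiv ⁻¹' V)) := by
  intro z hz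
  exact ((hFh _ (mem_interior_preimage_complexEquiv.1 hz)).comp_CLM l).comp_linearIsometryEquiv

include hVc in
theorem isPreconnected_interior_preimage_complexEquiv :
    IsPreconnected (interior (complexEquiv ⁻¹' V)) := by
  have h1 : interior (complexEquiv ⁻¹' V) = complexEquiv ⁻¹' interior V :=
    (complexEquiv.toHomeomorph.preimage_interior V).symm
  rw [h1]
  exact complexEquiv.toHomeomorph.isPreconnected_preimage.2 hVc.isPreconnected

include hV in
theorem isCompact_preimage_complexEquiv : IsCompact (complexEquiv ⁻¹' V) :=
  complexEquiv.toHomeomorph.isCompact_preimage.2 hV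

include hVc hFh in
theorem apply_eq_of_isLocalMax {l : Plane →L[ℝ] ℝ} {x : Plane} (hx : x ∈ interior V)
    (hmax : IsLocalMax (fun z ↦ l (F z)) x) : ∀ z ∈ interior V, l (F z) = l (F x) := by
  have hh := harmonicOnNhd_comp_complexEquiv hFh l
  have hmem : ∀ y, y ∈ interior V → complexEquiv.symm y ∈ interior (complexEquiv ⁻¹' V) :=
    fun y hy ↦ mem_interior_preimage_complexEquiv.2 (by simpa using hy)
  have hloc : IsLocalMax (fun z ↦ l (F (complexEquiv z))) (complexEquiv.symm x) := by
    refine IsLocalMax.comp_continuous (f := fun z ↦ l (F z)) ?_ complexEquiv.continuous.continuousAt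
    simpa using hmax
  intro z hz
  simpa using hh.eqOn_const_of_eventuallyEq (isPreconnected_interior_preimage_complexEquiv hVc)
    (hmem x hx) ((hh _ (hmem x hx)).eventually_eq_of_isLocalMax hloc) _ (hmem z hz)

include hV hVc hVcl hW hWc hWi hF hFh hFb in
theorem mapsTo_interior : MapsTo F (interior V) (interior W) := by
  intro x hx
  by_contra hFx
  obtain ⟨l, hl⟩ := geometric_hahn_banach_open_point hWc.interior isOpen_interior hFx
  have hl0 : l ≠ 0 := by
    rintro rfl
    obtain ⟨w, hw⟩ := hWi
    simpa using hl w hw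
  have hle : ∀ y ∈ W, l y ≤ l (F x) := by
    intro y hy
    have : y ∈ closure (interior W) := by
      rw [hWc.closure_interior_eq_closure_of_nonempty_interior hWi]
      exact subset_closure hy
    exact le_on_closure (fun a ha ↦ (hl a ha).le) l.continuous.continuousOn continuousOn_const this
  -- Whether the maximum of `l ∘ F` is attained inside `V` or on its boundary, it does not exceed
  -- the value at `x`; so `x` is itself an interior maximum.
  obtain ⟨m, hmV, hmax⟩ := hV.exists_isMaxOn ⟨x, interior_subset hx⟩
    (l.continuous.comp_continuousOn hF)
  have hxmax : ∀ z ∈ V, l (F z) ≤ l (F x) := by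
    intro z hz
    by_cases hm : m ∈ interior V
    · rw [apply_eq_of_isLocalMax hVc hFh hm
        (hmax.isLocalMax (mem_interior_iff_mem_nhds.1 hm)) x hx]
      exact hmax hz
    · have : l (F z) ≤ l (F m) := hmax hz
      exact this.trans (hle _ (hW.isClosed.frontier_subset
        (hFb.mapsTo ⟨subset_closure hmV, hm⟩)))
  have hloc : IsMaxOn (fun z ↦ l (F z)) V x := fun z hz ↦ hxmax z hz
  obtain ⟨z, hz, hne⟩ := exists_mem_interior_apply_ne hV hVcl hW hWc hWi hF hFb hl0 (l (F x))
  exact hne (apply_eq_of_isLocalMax hVc hFh hx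
    (hloc.isLocalMax (mem_interior_iff_mem_nhds.1 hx)) z hz)

include hV hW hWc hF hFb in
theorem isPreconnected_frontier_superlevel (l : Plane →L[ℝ] ℝ) {w : Plane}
    (hw : w ∈ interior W) :
    IsPreconnected {z ∈ frontier (complexEquiv ⁻¹' V) | l w < l (F (complexEquiv z))} := by
  have h1 := (hWc.isPreconnected_frontier_inter_halfSpace hW.isBounded hw l).inter_preimage_of_injOn
    (hV.of_isClosed_subset isClosed_frontier hV.isClosed.frontier_subset)
    (hF.mono hV.isClosed.frontier_subset) hFb.injOn
    (fun y hy ↦ hFb.surjOn hy.1)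
  have h2 := complexEquiv.toHomeomorph.isPreconnected_preimage.2 h1
  convert h2 using 1
  ext z
  have h3 : z ∈ frontier (complexEquiv ⁻¹' V) ↔ complexEquiv z ∈ frontier V := by
    have := complexEquiv.toHomeomorph.preimage_frontier V
    exact (Set.ext_iff.1 this z).symm
  constructor
  · rintro ⟨hz, hlt⟩
    exact ⟨h3.1 hz, hFb.mapsTo (h3.1 hz), hlt⟩
  · rintro ⟨hz, -, hlt⟩
    exact ⟨h3.2 hz, hlt⟩

include hV hVc hVcl hW hWc hWi hF hFh hFb in
theorem surjective_fderiv {x : Plane} (hx : x ∈ interior V) :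
    Function.Surjective (fderiv ℝ F x) := by
  rw [← ContinuousLinearMap.coe_coe, ← LinearMap.range_eq_top]
  by_contra hne
  -- A functional vanishing on the range of `dF` turns the degeneracy into a critical point of a
  -- scalar harmonic function.
  obtain ⟨f, hf0, hf⟩ := Submodule.exists_le_ker_of_lt_top _ (lt_top_iff_ne_top.2 hne)
  set l : Plane →L[ℝ] ℝ := f.toContinuousLinearMap with hl
  have hl0 : l ≠ 0 := by
    rintro h
    exact hf0 (LinearMap.ext fun v ↦ DFunLike.congr_fun h v)
  have hw := mapsTo_interior hV hVc hVcl hW hWc hWi hF hFh hFb hx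
  have hx' : complexEquiv.symm x ∈ interior (complexEquiv ⁻¹' V) :=
    mem_interior_preimage_complexEquiv.2 (by simpa using hx)
  obtain ⟨z, hz, hzne⟩ := exists_mem_interior_apply_ne hV hVcl hW hWc hWi hF hFb hl0 (l (F x))
  have hz' : complexEquiv.symm z ∈ interior (complexEquiv ⁻¹' V) :=
    mem_interior_preimage_complexEquiv.2 (by simpa using hz)
  refine fderiv_ne_zero_of_isPreconnected_frontier (isCompact_preimage_complexEquiv hV)
    (h := fun z ↦ l (F (complexEquiv z))) ?_ (harmonicOnNhd_comp_complexEquiv hFh l)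
    (isPreconnected_interior_preimage_complexEquiv hVc) hx' ⟨_, hz', by simpa using hzne⟩
    ?_ ?_ ?_
  · exact l.continuous.comp_continuousOn
      (hF.comp complexEquiv.continuous.continuousOn fun _ h ↦ h)
  · simpa using isPreconnected_frontier_superlevel hV hW hWc hF hFb l hw
  · simpa using isPreconnected_frontier_superlevel hV hW hWc hF hFb (-l) hw
  · have hd : HasFDerivAt F (fderiv ℝ F x) (complexEquiv (complexEquiv.symm x)) := by
      rw [LinearIsometryEquiv.apply_symm_apply]
      exact ((hFh x hx).1.differentiableAt two_ne_zero).hasFDerivAt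
    have h1 := (l.hasFDerivAt (x := F (complexEquiv (complexEquiv.symm x)))).comp (complexEquiv.symm x)
      (hd.comp _ complexEquiv.toContinuousLinearEquiv.hasFDerivAt)
    refine h1.fderiv.trans (ContinuousLinearMap.ext fun v ↦ ?_)
    exact hf (LinearMap.mem_range_self _ _)

include hV hVc hVcl hW hWc hWi hF hFh hFb in
theorem exists_openPartialHomeomorph {x : Plane} (hx : x ∈ interior V) :
    ∃ e : OpenPartialHomeomorph Plane Plane, x ∈ e.source ∧ F = e ∧
      ContDiffAt ℝ ∞ e.symm (F x) := by
  have hsurj := surjective_fderiv hV hVc hVcl hW hWc hWi hF hFh hFb hx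
  have hinj : Function.Injective (fderiv ℝ F x) :=
    (LinearMap.injective_iff_surjective (f := (fderiv ℝ F x).toLinearMap)).2 hsurj
  have hcd := contDiffAt_of_harmonicAt (hFh x hx)
  have h1 : HasFDerivAt F ((ContinuousLinearEquiv.ofBijective (fderiv ℝ F x)
      (LinearMap.ker_eq_bot.2 hinj) (LinearMap.range_eq_top.2 hsurj) : Plane ≃L[ℝ] Plane) :
        Plane →L[ℝ] Plane) x := by
    rw [ContinuousLinearEquiv.coe_ofBijective]
    exact (hcd.differentiableAt (by simp)).hasFDerivAt
  exact ⟨hcd.toOpenPartialHomeomorph F h1 (by simp),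
    hcd.mem_toOpenPartialHomeomorph_source h1 (by simp), rfl, hcd.to_localInverse h1 (by simp)⟩

include hV hVc hVcl hW hWc hWi hF hFh hFb in
/-- The **Radó–Kneser–Choquet theorem**. -/
theorem bijOn_and_isDiffeoOn_of_harmonic :
    BijOn F V W ∧ IsDiffeoOn F (interior V) (interior W) := by
  have hhom := fun x (hx : x ∈ interior V) ↦
    exists_openPartialHomeomorph hV hVc hVcl hW hWc hWi hF hFh hFb hx
  have hdisj : ∀ y ∈ frontier W, y ∉ interior W := fun y hy hy' ↦ hy.2 hy'
  have hin := mapsTo_interior hV hVc hVcl hW hWc hWi hF hFh hFb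
  have hbij : BijOn F (interior V) (interior W) := by
    refine bijOn_of_isLocalHomeomorphOn hV hF isOpen_interior hVc interior_subset isOpen_interior
      hWc.interior hin (fun x hx hxi ↦ hdisj _ (hFb.mapsTo ⟨subset_closure hx, hxi⟩)) ?_
    intro x hx
    obtain ⟨e, he, hFe, -⟩ := hhom x hx
    exact ⟨e, he, hFe⟩
  refine ⟨?_, isOpen_interior, isOpen_interior, hbij,
    fun x hx ↦ (contDiffAt_of_harmonicAt (hFh x hx)).contDiffWithinAt,
    Function.invFunOn F (interior V), hbij.invOn_invFunOn, ?_⟩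
  · rw [← hV.isClosed.closure_eq, ← hW.isClosed.closure_eq, closure_eq_interior_union_frontier,
      closure_eq_interior_union_frontier]
    refine hbij.union hFb ?_
    rintro x (hx | hx) y (hy | hy) hxy
    · exact hbij.injOn hx hy hxy
    · exact absurd (hxy ▸ hin hx) (hdisj _ (hFb.mapsTo hy))
    · exact absurd (hxy ▸ hin hy) (hdisj _ (hFb.mapsTo hx))
    · exact hFb.injOn hx hy hxy
  · intro y hy
    obtain ⟨x, hx, rfl⟩ := hbij.surjOn hy
    obtain ⟨e, he, hFe, hsm⟩ := hhom x hx
    refine ContDiffAt.contDiffWithinAt (hsm.congr_of_eventuallyEq ?_)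
    have htgt : F x ∈ e.target := by rw [hFe]; exact e.map_source he
    have hsymm : e.symm (F x) = x := by rw [hFe]; exact e.left_inv he
    -- Near `F x` the smooth local inverse takes values in the interior of `V`, where `F` is
    -- injective, so it agrees with the global inverse.
    have hev : ∀ᶠ z in 𝓝 (F x), e.symm z ∈ interior V := by
      refine (e.continuousAt_symm htgt).eventually (isOpen_interior.mem_nhds ?_)
      rwa [hsymm]
    filter_upwards [hev, e.open_target.mem_nhds htgt] with z hz hzt
    have hFz : F (e.symm z) = z := by rw [hFe]; exact e.right_inv hzt
    have hzW : z ∈ interior W := hFz ▸ hin hz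
    refine hbij.injOn (hbij.surjOn.mapsTo_invFunOn hzW) hz ?_
    rw [hFz]
    exact hbij.invOn_invFunOn.2 hzW

end RadoKneserChoquet

/-! ### Boundary values and harmonicity of the barycentric map. -/

section Boundary

variable {n : ℕ} {P Q : Polygon Plane n} {V : Set Plane} {φ : Fin n → Plane → ℝ}

theorem edgePath_eq (P : Polygon Plane n) (j : Fin n) (t : ℝ) :
    P.edgePath ℝ j t = (1 - t) • P j + t • P (finRotate n j) :=
  AffineMap.lineMap_apply_module _ _ _

theorem mem_boundary_iff {x : Plane} :
    x ∈ P.boundary ℝ ↔ ∃ j, ∃ t ∈ Ico (0 : ℝ) 1, P.edgePath ℝ j t = x := by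
  simp only [Polygon.boundary, mem_iUnion, Polygon.edgeSet_eq_image_edgePath]
  constructor
  · rintro ⟨j, t, ht, rfl⟩
    rcases ht.2.lt_or_eq with h | rfl
    · exact ⟨j, t, ⟨ht.1, h⟩, rfl⟩
    -- The final vertex of an edge is counted as the start of the next one.
    · exact ⟨finRotate n j, 0, by simp, by simp [edgePath_eq]⟩
  · rintro ⟨j, t, ht, rfl⟩
    exact ⟨j, t, ⟨ht.1, ht.2.le⟩, rfl⟩

theorem IsGBC.gbcMap_edgePath (hφ : IsGBC P V φ) (Q : Polygon Plane n) (j : Fin n) {t : ℝ}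
    (ht : t ∈ Icc (0 : ℝ) 1) : gbcMap φ Q (P.edgePath ℝ j t) = Q.edgePath ℝ j t := by
  simp only [gbcMap, hφ.linear_on_edge _ j t ht, hφ.apply_vertex, edgePath_eq Q, add_smul,
    Finset.sum_add_distrib, mul_ite, mul_one, mul_zero, ite_smul, zero_smul, Finset.sum_ite_eq',
    Finset.mem_univ, if_true]

/-- The map preserves the edge index and the edge parameter, and simplicity of `Q` recovers both
from the image point. -/
theorem IsGBC.bijOn_boundary (hφ : IsGBC P V φ) (hQ : IsSimple Q) :
    BijOn (gbcMap φ Q) (P.boundary ℝ) (Q.boundary ℝ) := by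
  refine ⟨fun x hx ↦ ?_, fun x hx y hy hxy ↦ ?_, fun y hy ↦ ?_⟩
  · obtain ⟨j, t, ht, rfl⟩ := mem_boundary_iff.1 hx
    rw [hφ.gbcMap_edgePath Q j (Ico_subset_Icc_self ht)]
    exact mem_boundary_iff.2 ⟨j, t, ht, rfl⟩
  · obtain ⟨j, t, ht, rfl⟩ := mem_boundary_iff.1 hx
    obtain ⟨k, s, hs, rfl⟩ := mem_boundary_iff.1 hy
    rw [hφ.gbcMap_edgePath Q j (Ico_subset_Icc_self ht),
      hφ.gbcMap_edgePath Q k (Ico_subset_Icc_self hs)] at hxy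
    obtain ⟨rfl, rfl⟩ := hQ j k t ht s hs hxy
    rfl
  · obtain ⟨j, t, ht, rfl⟩ := mem_boundary_iff.1 hy
    exact ⟨P.edgePath ℝ j t, mem_boundary_iff.2 ⟨j, t, ht, rfl⟩,
      hφ.gbcMap_edgePath Q j (Ico_subset_Icc_self ht)⟩

theorem IsHarmonicGBC.continuousOn_gbcMap (hφ : IsHarmonicGBC P V φ) (Q : Polygon Plane n) :
    ContinuousOn (gbcMap φ Q) V :=
  continuousOn_finsetSum _ fun i _ ↦ (hφ.continuousOn i).smul continuousOn_const

theorem IsHarmonicGBC.harmonicOnNhd_gbcMap (hφ : IsHarmonicGBC P V φ) (Q : Polygon Plane n) :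
    HarmonicOnNhd (gbcMap φ Q) (interior V) := by
  have h : gbcMap φ Q = ∑ i, ContinuousLinearMap.toSpanSingleton ℝ (Q i) ∘ φ i := by
    ext x : 1
    simp [gbcMap, Finset.sum_apply]
  rw [h]
  intro x hx
  exact Finset.sum_induction _ (fun f : Plane → Plane ↦ HarmonicAt f x)
    (fun _ _ hf hg ↦ hf.add hg) (harmonicAt_const (0 : Plane))
    fun i _ ↦ (hφ.harmonic i x hx).comp_CLM _

end Boundary

end HarmonicGBC

end

theorem theorem1 {n : ℕ} (P Q : Polygon HarmonicGBC.Plane n) (V W : Set HarmonicGBC.Plane)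
    (hV : HarmonicGBC.IsPolygonalRegion P V) (hW : HarmonicGBC.IsPolygonalRegion Q W)
    (hP : HarmonicGBC.IsCounterclockwise P) (hQ : HarmonicGBC.IsCounterclockwise Q)
    (hconv : Convex ℝ W)
    (φ : Fin n → HarmonicGBC.Plane → ℝ) (hφ : HarmonicGBC.IsHarmonicGBC P V φ) :
    Set.BijOn (HarmonicGBC.gbcMap φ Q) V W ∧
      HarmonicGBC.IsDiffeoOn (HarmonicGBC.gbcMap φ Q) (interior V) (interior W) := by
  refine HarmonicGBC.bijOn_and_isDiffeoOn_of_harmonic hV.isCompact hV.isConnected_interior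
    hV.closure_interior hW.isCompact hconv hW.isConnected_interior.nonempty
    (hφ.continuousOn_gbcMap Q) (hφ.harmonicOnNhd_gbcMap Q) ?_
  rw [hV.frontier_eq, hW.frontier_eq]
  exact hφ.toIsGBC.bijOn_boundary hW.isSimple
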